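/- Let $\lambda_1,\dots,\lambda_n,\tilde\lambda_1,\dots,\tilde\lambda_n\in\mathbb C^2$ be spinors of $n$ massless particles in four dimensions, with momenta $k_a^\mu=\tfrac12\langle a|\gamma^\mu|a]$ satisfying $\sum_a k_a=0$. Write $\langle ab\rangle$, $[ab]$ for the antisymmetric spinor brackets, normalized so that $\langle x|\gamma^\mu|y]\langle z|\gamma_\mu|w]=2\langle xz\rangle[wy]$, and $s_{ab}=2k_a\cdot k_b=-\langle ab\rangle[ab]$. Let $|p\rangle$, $|q]$ be reference spinors with $\langle ap\rangle\ne0$ and $[aq]\neq 0$ for all $a$. A solution of the scattering equations is a tuple $\sigma\in\mathbb C^n$ of pairwise distinct points with $\sum_{b\ne a}s_{ab}/\sigma_{ab}=0$ for all $a$, where $\sigma_{ab}=\sigma_a-\sigma_b$. Define the $n\times n$ discriminant matrices $$(\mathfrak C_-)_{ab}=\frac{\langle ab\rangle}{\sigma_{ab}}\ (a\ne b),\quad (\mathfrak C_-)_{aa}=-\sum_{c\ne a}\frac{\langle ac\rangle[cq]}{\sigma_{ac}[aq]},\qquad (\mathfrak C_+)_{ab}=\frac{[ab]}{\sigma_{ab}}\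 (a\ne b),\quad (\mathfrak C_+)_{aa}=-\sum_{c\ne a}\frac{[ac]\langle cp\rangle}{\sigma_{ac}\langle ap\rangle},$$ and, for $m\in\mathbb Z$, let $\boldsymbol P_\pm(n-3,m)$ be the set of solutions $\sigma$ with $\operatorname{rank}\mathfrak C_\pm(\sigma)=m+1$. Given a helicity assignment, put $\epsilon_a(-)=\langle a|\gamma^\mu|q]/(\sqrt2[qa])$, $\epsilon_a(+)=\langle p|\gamma^\mu|a]/(\sqrt2\langle pa\rangle)$, and let $\Psi=\begin{pmatrix}A&-C^T\\C&B\end{pmatrix}$ with $$A_{ab}=\frac{s_{ab}}{\sigma_{ab}},\quad B_{ab}=\frac{\epsilon_a\cdot\epsilon_b}{\sigma_{ab}},\quad C_{ab}=-\frac{\sqrt2\,\epsilon_a\cdot k_b}{\sigma_{ab}}\quad(a\neq b),\qquad A_{aa}=B_{aa}=0,\quad C_{aa}=\sum_{c\neq a}\frac{\sqrt2\,\epsilon_a\cdot k_c}{\sigma_{ac}}.$$ For $1\le i<j\le n$ let $\mathrm{Pf}'(\Psi)=\frac{(-1)^{i+j}}{\sigma_{ij}}\mathrm{Pf}(\Psi^{ij}_{ij})$,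 where $\Psi^{ij}_{ij}$ is $\Psi$ with the $i$-th and $j$-th rows and columns deleted. The configuration is N$^k$MHV if exactly $k+2$ particles have negative helicity. Then: (0) If at least one $\langle ab\rangle$ is nonzero and at least one $[ab]$ is nonzero, the solution set is $\bigcup_{m=0}^{n-4}\boldsymbol P_-(n-3,m)=\bigcup_{m=0}^{n-4}\boldsymbol P_+(n-3,m)$; for each sign the classes with different $m$ are disjoint. (1) At any N$^k$MHV helicity configuration, a solution $\sigma$ with $\mathrm{Pf}'(\Psi)\neq0$ (for any choice of $i<j$) lies in $\boldsymbol P_-(n-3,k)$. (2) At any N$^{n-k-4}$MHV helicity configuration, a solution $\sigma$ with $\mathrm{Pf}'(\Psi)\neq0$ (for any choice of $i<j$) lies in $\boldsymbol P_+(n-3,k)$. (3) Statements (1) and (2) also hold with $\mathrm{Pf}'(\Psi)$ replaced by the Yang–Mills integrand $(-\sqrt2)^n\,\mathrm{Pf}'(\Psi)/(\sigma_{12}\sigma_{23}\cdots\sigma_{n1})$, the gravity integrand $2^n\,\mathrm{Pf}'(\Psi)^2$, or the single-trace Einstein–Yang–Mills integrand $(-\sqrt2)^{n+s}\,\mathrm{Pf}(\Psi_{\mathsf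 h})\,\mathrm{Pf}'(\Psi)/(\sigma_{g_1g_2}\cdots\sigma_{g_rg_1})$ for gluons $g_1,\dots,g_r$ and $s=n-r$ gravitons, where $\Psi_{\mathsf h}$ is the $2s\times2s$ submatrix of $\Psi$ whose rows and columns are those labelled by gravitons, in both blocks. -/

import Mathlib

namespace CHY

noncomputable section

/-! ### Spinor-helicity kinematics in four dimensions (complexified) -/

/-- Two-component spinors. Angle spinors `|a⟩` and square spinors `|a]` both live here. -/
abbrev Spinor := Fin 2 → ℂ

/-- Complexified four-vectors. -/
abbrev FourVec := Fin 4 → ℂ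

/-- The angle bracket `⟨x y⟩`. -/
def angle (x y : Spinor) : ℂ := x 0 * y 1 - x 1 * y 0

/-- The square bracket `[x y]`, with the relative sign for which `2 k_a · k_b = -⟨ab⟩[ab]`. -/
def square (x y : Spinor) : ℂ := x 1 * y 0 - x 0 * y 1

/-- The matrices `σ^μ = (1, σ₁, σ₂, σ₃)`. -/
def pauli : Fin 4 → Matrix (Fin 2) (Fin 2) ℂ :=
  ![1, !![0, 1; 1, 0], !![0, -Complex.I; Complex.I, 0], !![1, 0; 0, -1]]

/-- The four-vector `⟨x|γ^μ|y]`. -/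
def sandwich (x y : Spinor) : FourVec := fun μ => x ⬝ᵥ (pauli μ).mulVec y

/-- The (complex bilinear) Minkowski product of signature `(+,-,-,-)`. -/
def mdot (u v : FourVec) : ℂ := u 0 * v 0 - u 1 * v 1 - u 2 * v 2 - u 3 * v 3

/-- The Fierz identity `⟨x|γ^μ|y] ⟨z|γ_μ|w] = 2 ⟨xz⟩[wy]`, fixing all sign conventions. -/
theorem mdot_sandwich (x y z w : Spinor) :
    mdot (sandwich x y) (sandwich z w) = 2 * angle x z * square w y := by
  simp only [mdot, sandwich, pauli, angle, square, Matrix.mulVec, dotProduct, Fin.sum_univ_two,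
    Matrix.cons_val, Matrix.of_apply, Matrix.cons_val', Matrix.one_apply]
  simp
  ring_nf
  simp only [Complex.I_sq]
  ring

section Particles

variable {n : ℕ} (lam lamT : Fin n → Spinor) (p q : Spinor)

/-- The null momentum `k_a^μ = ½ ⟨a|γ^μ|a]`. -/
def momentum (a : Fin n) : FourVec := (1 / 2 : ℂ) • sandwich (lam a) (lamT a)

/-- The Mandelstam variable `s_ab = 2 k_a · k_b`. -/
def mandelstam (a b : Fin n) : ℂ := 2 * mdot (momentum lam lamT a) (momentum lam lamT b)

/-- A solution of the scattering equations: pairwise distinct punctures with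
`∑_{b ≠ a} s_ab / (σ_a - σ_b) = 0` for every `a`. -/
def IsSolution (σ : Fin n → ℂ) : Prop :=
  Function.Injective σ ∧
    ∀ a, ∑ b ∈ Finset.univ.erase a, mandelstam lam lamT a b / (σ a - σ b) = 0

/-! ### Discriminant matrices and the two families of classes -/

/-- The discriminant matrix `𝔆₋`. -/
def discMinus (σ : Fin n → ℂ) : Matrix (Fin n) (Fin n) ℂ := Matrix.of fun a b =>
  if a = b then
    -∑ c ∈ Finset.univ.erase a,
      angle (lam a) (lam c) * square (lamT c) q / ((σ a - σ c) * square (lamT a) q)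
  else angle (lam a) (lam b) / (σ a - σ b)

/-- The discriminant matrix `𝔆₊`. -/
def discPlus (σ : Fin n → ℂ) : Matrix (Fin n) (Fin n) ℂ := Matrix.of fun a b =>
  if a = b then
    -∑ c ∈ Finset.univ.erase a,
      square (lamT a) (lamT c) * angle (lam c) p / ((σ a - σ c) * angle (lam a) p)
  else square (lamT a) (lamT b) / (σ a - σ b)

/-- The class `P₋(n-3, m)`: solutions with `rank 𝔆₋ = m + 1`. -/
def PMinus (m : ℤ) : Set (Fin n → ℂ) :=
  {σ | IsSolution lam lamT σ ∧ ((discMinus lam lamT q σ).rank : ℤ) = m + 1}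

/-- The class `P₊(n-3, m)`: solutions with `rank 𝔆₊ = m + 1`. -/
def PPlus (m : ℤ) : Set (Fin n → ℂ) :=
  {σ | IsSolution lam lamT σ ∧ ((discPlus lam lamT p σ).rank : ℤ) = m + 1}

/-! ### Helicities, polarizations and the matrix `Ψ` -/

/-- A helicity configuration is given by the set `neg` of negative-helicity particles; it is
N^kMHV when there are `k + 2` of them. -/
def IsNkMHV (neg : Finset (Fin n)) (k : ℤ) : Prop := (neg.card : ℤ) = k + 2

/-- The polarization vectors `ε_a(-) = ⟨a|γ^μ|q] / (√2 [qa])`, `ε_a(+) = ⟨p|γ^μ|a] / (√2 ⟨pa⟩)`. -/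
def polarization (neg : Finset (Fin n)) (a : Fin n) : FourVec :=
  if a ∈ neg then
    (1 / ((Real.sqrt 2 : ℂ) * square q (lamT a))) • sandwich (lam a) q
  else
    (1 / ((Real.sqrt 2 : ℂ) * angle p (lam a))) • sandwich p (lamT a)

/-- The block `A` of `Ψ`. -/
def blockA (σ : Fin n → ℂ) : Matrix (Fin n) (Fin n) ℂ := Matrix.of fun a b =>
  if a = b then 0 else mandelstam lam lamT a b / (σ a - σ b)

/-- The block `B` of `Ψ`. -/
def blockB (neg : Finset (Fin n)) (σ : Fin n → ℂ) : Matrix (Fin n) (Fin n) ℂ :=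
  Matrix.of fun a b =>
    if a = b then 0
    else mdot (polarization lam lamT p q neg a) (polarization lam lamT p q neg b) / (σ a - σ b)

/-- The block `C` of `Ψ`. -/
def blockC (neg : Finset (Fin n)) (σ : Fin n → ℂ) : Matrix (Fin n) (Fin n) ℂ :=
  Matrix.of fun a b =>
    if a = b then
      ∑ c ∈ Finset.univ.erase a,
        (Real.sqrt 2 : ℂ) * mdot (polarization lam lamT p q neg a) (momentum lam lamT c)
          / (σ a - σ c)
    else
      -((Real.sqrt 2 : ℂ) * mdot (polarization lam lamT p q neg a) (momentum lam lamT b)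
          / (σ a - σ b))

/-- The `2n × 2n` matrix `Ψ = (A, -Cᵀ; C, B)`, with rows and columns ordered as
`1, …, n` (upper block) followed by `1, …, n` (lower block). -/
def Psi (neg : Finset (Fin n)) (σ : Fin n → ℂ) : Matrix (Fin (n + n)) (Fin (n + n)) ℂ :=
  (Matrix.fromBlocks (blockA lam lamT σ) (-(blockC lam lamT p q neg σ).transpose)
    (blockC lam lamT p q neg σ) (blockB lam lamT p q neg σ)).submatrix
      finSumFinEquiv.symm finSumFinEquiv.symm

end Particles

/-! ### Pfaffians -/

/-- The Pfaffian of a `2m × 2m` (antisymmetric) matrix,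
`1/(2^m m!) ∑_π sgn(π) ∏_{t < m} M_{π(2t), π(2t+1)}`. -/
def pfaffian {m : ℕ} (M : Matrix (Fin (2 * m)) (Fin (2 * m)) ℂ) : ℂ :=
  (1 / ((2 : ℂ) ^ m * (m.factorial : ℂ))) *
    ∑ π : Equiv.Perm (Fin (2 * m)), ((Equiv.Perm.sign π : ℤ) : ℂ) *
      ∏ t : Fin m, M (π ⟨2 * (t : ℕ), by omega⟩) (π ⟨2 * (t : ℕ) + 1, by omega⟩)

/-- The Pfaffian of the principal submatrix of `M` with rows and columns in `S`, taken in
increasing order (zero if `S` has odd size). -/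
def pfaffianOn {N : ℕ} (M : Matrix (Fin N) (Fin N) ℂ) (S : Finset (Fin N)) : ℂ :=
  if h : S.card = 2 * (S.card / 2) then
    pfaffian (M.submatrix (S.orderEmbOfFin h) (S.orderEmbOfFin h))
  else 0

section Integrands

variable {n : ℕ} (lam lamT : Fin n → Spinor) (p q : Spinor)

/-- The reduced Pfaffian `Pf′(Ψ) = (-1)^{i+j} / σ_ij · Pf(Ψ_ij^ij)`: rows and columns `i`, `j`
of the upper block are deleted. -/
def reducedPf (neg : Finset (Fin n)) (σ : Fin n → ℂ) (i j : Fin n) : ℂ :=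
  (-1) ^ ((i : ℕ) + (j : ℕ)) / (σ i - σ j) *
    pfaffianOn (Psi lam lamT p q neg σ)
      (Finset.univ \ {Fin.castAdd n i, Fin.castAdd n j})

/-- `Pf(Ψ_h)` for a set `hs` of gravitons: `Ψ_h` consists of the rows and columns of `Ψ`
labelled by gravitons, in both blocks. -/
def pfPsiH (neg : Finset (Fin n)) (σ : Fin n → ℂ) (hs : Finset (Fin n)) : ℂ :=
  pfaffianOn (Psi lam lamT p q neg σ)
    (hs.map (Fin.castAddEmb n) ∪ hs.map (Fin.natAddEmb n))

/-- The Yang-Mills integrand `(-√2)^n Pf′(Ψ) / (σ₁₂ σ₂₃ ⋯ σ_{n1})`. -/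
def integrandYM (neg : Finset (Fin n)) (σ : Fin n → ℂ) (i j : Fin n) : ℂ :=
  (-(Real.sqrt 2 : ℂ)) ^ n * reducedPf lam lamT p q neg σ i j /
    ∏ a : Fin n, (σ a - σ (finRotate n a))

/-- The pure-gravity integrand `2^n Pf′(Ψ) Pf′(Ψ)`. -/
def integrandGravity (neg : Finset (Fin n)) (σ : Fin n → ℂ) (i j : Fin n) : ℂ :=
  2 ^ n * (reducedPf lam lamT p q neg σ i j * reducedPf lam lamT p q neg σ i j)

/-- The single-trace Einstein-Yang-Mills integrand
`(-√2)^{n+s} Pf(Ψ_h) Pf′(Ψ) / (σ_{g₁g₂} ⋯ σ_{g_r g₁})`; the gluons are `g₁, …, g_r` in colour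
order and the `s` remaining particles are the gravitons. -/
def integrandEYM (neg : Finset (Fin n)) (σ : Fin n → ℂ) {r : ℕ} (g : Fin r ↪ Fin n)
    (i j : Fin n) : ℂ :=
  (-(Real.sqrt 2 : ℂ)) ^ (n + (Finset.univ \ Finset.univ.map g).card) *
    pfPsiH lam lamT p q neg σ (Finset.univ \ Finset.univ.map g) *
    reducedPf lam lamT p q neg σ i j /
    ∏ t : Fin r, (σ (g t) - σ (g (finRotate r t)))

end Integrands

end

end CHY
/-!
Deleting rows `i` and `j` costs the upper block of `Ψ` two dimensions, so when `Pf′(Ψ) ≠ 0` any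
subspaces `X` of the upper and `Y` of the lower block whose sum is isotropic for `Ψ` satisfy
`dim X + dim Y ≤ n + 1`. Take for `Y` the span of the negative-helicity coordinates and for `X` the
kernel of `𝔆₋` with columns rescaled by `[bq]`: on negative rows the block `C` is proportional to
that matrix, the block `B` vanishes there, and `A` vanishes on the kernel by the Schouten identity.
Hence `#neg ≤ rank 𝔆₋ + 1`. Parity, which exchanges angle and square spinors and flips all
helicities, gives `#pos ≤ rank 𝔆₊ + 1`.

Conversely the commutators of `𝔆₋` and `𝔆₊` with `diag σ` are the matrices of angle and of square
brackets. The scattering equations say that `𝔆₋` kills the square spinors and `𝔆₊` the angle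
spinors, so `𝔆₋ 𝔆₊` commutes with `diag σ`; it kills a vector without zero entries, hence
vanishes. Thus `im 𝔆₊ ⊂ im 𝔆₊ + {([az])ₐ : z} ⊂ ker 𝔆₋`, both inclusions being strict when
`𝔆₋ ≠ 0` because a subspace stable under `diag σ` that contains a vector without zero entries is
everything; when `𝔆₋ = 0`, it is enough that `(⟨ap⟩)ₐ` and its image under `diag σ` lie in `ker 𝔆₊`.
So `rank 𝔆₊ + rank 𝔆₋ + 2 ≤ n`, and all three inequalities are equalities as soon as
`Pf′(Ψ) ≠ 0`.
-/

namespace CHY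

open Matrix

section Pfaffian

variable {m : ℕ} {ι : Type*}

theorem prod_univ_two_mul {M : Type*} [CommMonoid M] (h : Fin (2 * m) → M) :
    ∏ s, h s = ∏ t : Fin m, h ⟨2 * t, by omega⟩ * h ⟨2 * t + 1, by omega⟩ := by
  induction m with
  | zero => simp
  | succ m ih =>
    change ∏ s : Fin (2 * m + 1 + 1), h s = _
    rw [Fin.prod_univ_castSucc, Fin.prod_univ_castSucc, Fin.prod_univ_castSucc (n := m),
      ih fun s => h s.castSucc.castSucc, mul_assoc]
    rfl

/-- The sequence `(f 0).1, (f 0).2, (f 1).1, (f 1).2, …`. It lists the columns of `B` that occur in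
one term of the expansion of the Pfaffian of `B * M * Bᵀ`. -/
def flattenPairs (f : Fin m → ι × ι) (s : Fin (2 * m)) : ι :=
  if (s : ℕ) % 2 = 0 then (f ⟨s / 2, by omega⟩).1 else (f ⟨s / 2, by omega⟩).2

theorem flattenPairs_even (f : Fin m → ι × ι) (t : Fin m) :
    flattenPairs f ⟨2 * t, by omega⟩ = (f t).1 := by
  simp [flattenPairs]

theorem flattenPairs_odd (f : Fin m → ι × ι) (t : Fin m) :
    flattenPairs f ⟨2 * t + 1, by omega⟩ = (f t).2 := by
  have h : (2 * (t : ℕ) + 1) / 2 = t := by omega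
  simp [flattenPairs, h, Nat.add_mod]

theorem pfaffian_mul_mul_transpose_eq_sum_det [Fintype ι] (B : Matrix (Fin (2 * m)) ι ℂ)
    (M : Matrix ι ι ℂ) :
    pfaffian (B * M * Bᵀ) = 1 / (2 ^ m * (m.factorial : ℂ)) *
      ∑ f : Fin m → ι × ι, (∏ t, M (f t).1 (f t).2) * (B.submatrix id (flattenPairs f)).det := by
  have hentry (x y) : (B * M * Bᵀ) x y = ∑ kl : ι × ι, M kl.1 kl.2 * (B x kl.1 * B y kl.2) := by
    simp only [Matrix.mul_apply, transpose_apply, Finset.sum_mul, Fintype.sum_prod_type_right]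
    exact Finset.sum_congr rfl fun _ _ => Finset.sum_congr rfl fun _ _ => by ring
  unfold pfaffian
  simp only [hentry, Finset.prod_univ_sum, Fintype.piFinset_univ, det_apply', Finset.mul_sum]
  rw [Finset.sum_comm]
  refine Finset.sum_congr rfl fun f _ => Finset.sum_congr rfl fun π _ => ?_
  simp only [prod_univ_two_mul, submatrix_apply, id, flattenPairs_even, flattenPairs_odd,
    Finset.prod_mul_distrib]
  ring

theorem pfaffian_mul_mul_transpose (B M : Matrix (Fin (2 * m)) (Fin (2 * m)) ℂ) :
    pfaffian (B * M * Bᵀ) = B.det * pfaffian M := by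
  have hM := pfaffian_mul_mul_transpose_eq_sum_det (1 : Matrix (Fin (2 * m)) (Fin (2 * m)) ℂ) M
  rw [transpose_one, Matrix.one_mul, Matrix.mul_one] at hM
  rw [pfaffian_mul_mul_transpose_eq_sum_det, hM, mul_left_comm]
  congr 1
  rw [Finset.mul_sum]
  refine Finset.sum_congr rfl fun f _ => ?_
  have hB : B.submatrix id (flattenPairs f) =
      B * (1 : Matrix _ _ ℂ).submatrix id (flattenPairs f) := by
    ext x y
    simp [Matrix.mul_apply, Matrix.one_apply]
  rw [hB, det_mul, mul_left_comm]

theorem pfaffian_eq_zero_of_row_col_eq_zero (M : Matrix (Fin (2 * m)) (Fin (2 * m)) ℂ)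
    (s : Fin (2 * m)) (hrow : ∀ x, M s x = 0) (hcol : ∀ x, M x s = 0) : pfaffian M = 0 := by
  refine mul_eq_zero_of_right _ (Finset.sum_eq_zero fun π _ => mul_eq_zero_of_right _ ?_)
  obtain ⟨u, rfl⟩ := π.surjective s
  refine Finset.prod_eq_zero (Finset.mem_univ ⟨u / 2, by omega⟩) ?_
  rcases Nat.mod_two_eq_zero_or_one u with hu | hu
  · have : (⟨2 * (u / 2), by omega⟩ : Fin (2 * m)) = u :=
      Fin.ext (by change 2 * _ = _; omega)
    simp only [this, hrow]
  · have : (⟨2 * (u / 2) + 1, by omega⟩ : Fin (2 * m)) = u :=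
      Fin.ext (by change 2 * _ + 1 = _; omega)
    simp only [this, hcol]

theorem det_ne_zero_of_pfaffian_ne_zero {M : Matrix (Fin (2 * m)) (Fin (2 * m)) ℂ}
    (hM : Mᵀ = -M) (hpf : pfaffian M ≠ 0) : M.det ≠ 0 := by
  intro hdet
  obtain ⟨v, hv, hMv⟩ := exists_mulVec_eq_zero_iff.2 hdet
  obtain ⟨s, hs⟩ := Function.ne_iff.1 hv
  -- as `M *ᵥ v = 0`, congruence by the matrix `B` clears row and column `s` of `M`
  set B := (1 : Matrix (Fin (2 * m)) (Fin (2 * m)) ℂ).updateRow s v with hB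
  have hBdet : B.det = v s := by
    rw [hB, ← cramer_transpose_apply, transpose_one, cramer_one, Module.End.one_apply]
  have hcol (x) : (B * M * Bᵀ) x s = 0 := by
    have hBs : Bᵀ *ᵥ Pi.single s 1 = v := by
      rw [mulVec_single_one]
      exact updateRow_self
    change (B * M * Bᵀ).col s x = 0
    rw [← mulVec_single_one, ← mulVec_mulVec, hBs, ← mulVec_mulVec, hMv, mulVec_zero,
      Pi.zero_apply]
  have hskew : (B * M * Bᵀ)ᵀ = -(B * M * Bᵀ) := by
    simp [transpose_mul, hM, Matrix.mul_assoc]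
  have hrow (x) : (B * M * Bᵀ) s x = 0 := by
    rw [← transpose_apply (B * M * Bᵀ), hskew, Matrix.neg_apply, hcol, neg_zero]
  have hzero := pfaffian_eq_zero_of_row_col_eq_zero _ s hrow hcol
  rw [pfaffian_mul_mul_transpose, hBdet] at hzero
  exact mul_ne_zero hs hpf hzero

end Pfaffian

section Isotropic

theorem two_mul_finrank_le_card_of_isotropic {K κ : Type*} [Field K] [Fintype κ] [DecidableEq κ]
    {M : Matrix κ κ K} (hM : M.det ≠ 0) {W : Submodule K (κ → K)}
    (hW : ∀ x ∈ W, ∀ y ∈ W, x ⬝ᵥ M *ᵥ y = 0) : 2 * Module.finrank K W ≤ Fintype.card κ := by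
  let F : (κ → K) →ₗ[K] Module.Dual K (κ → K) := (dotProductEquiv K κ).toLinearMap ∘ₗ M.mulVecLin
  have hF : Function.Injective F :=
    (dotProductEquiv K κ).injective.comp (mulVec_injective_of_det_ne_zero hM)
  have hle : W.map F ≤ W.dualAnnihilator := by
    rintro _ ⟨y, hy, rfl⟩
    refine (Submodule.mem_dualAnnihilator _).2 fun x hx => ?_
    exact (dotProduct_comm _ _).trans (hW x hx y hy)
  have hann := Subspace.finrank_add_finrank_dualAnnihilator_eq W
  have hmono := Submodule.finrank_mono hle
  rw [← (W.equivMapOfInjective F hF).finrank_eq] at hmono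
  rw [Module.finrank_fintype_fun_eq_card] at hann
  omega

variable {N : ℕ} {ι : Type*} [Fintype ι]

theorem dotProduct_comp_submatrix_mulVec_comp {R κ : Type*} [NonUnitalNonAssocSemiring R]
    [Fintype κ] {f : κ → ι} (hf : Function.Injective f) (M : Matrix ι ι R) {x y : ι → R}
    (hx : ∀ a ∉ Set.range f, x a = 0) (hy : ∀ a ∉ Set.range f, y a = 0) :
    (x ∘ f) ⬝ᵥ M.submatrix f f *ᵥ (y ∘ f) = x ⬝ᵥ M *ᵥ y := by
  refine Fintype.sum_of_injective f hf _ _ (fun a ha => by rw [hx a ha, zero_mul]) fun k => ?_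
  congr 1
  exact Fintype.sum_of_injective f hf _ _ (fun a ha => by rw [hy a ha, mul_zero]) fun _ => rfl

theorem two_mul_finrank_le_card_of_pfaffianOn_ne_zero (e : ι ≃ Fin N) {M : Matrix ι ι ℂ}
    (hM : Mᵀ = -M) {S : Finset (Fin N)} (hpf : pfaffianOn (M.submatrix e.symm e.symm) S ≠ 0)
    {W : Submodule ℂ (ι → ℂ)} (hsupp : ∀ x ∈ W, ∀ a, e a ∉ S → x a = 0)
    (hW : ∀ x ∈ W, ∀ y ∈ W, x ⬝ᵥ M *ᵥ y = 0) : 2 * Module.finrank ℂ W ≤ S.card := by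
  obtain ⟨hS, hpf⟩ : ∃ hS : S.card = 2 * (S.card / 2),
      pfaffian ((M.submatrix e.symm e.symm).submatrix
        (S.orderEmbOfFin hS) (S.orderEmbOfFin hS)) ≠ 0 := by
    simpa only [pfaffianOn, ne_eq, dite_eq_right_iff, not_forall] using hpf
  set f : Fin (2 * (S.card / 2)) → ι := e.symm ∘ S.orderEmbOfFin hS
  have hf : Function.Injective f := e.symm.injective.comp (S.orderEmbOfFin hS).injective
  have hfW : ∀ x ∈ W, ∀ a ∉ Set.range f, x a = 0 := by
    refine fun x hx a ha => hsupp x hx a fun haS => ha ?_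
    obtain ⟨s, hs⟩ : e a ∈ Set.range (S.orderEmbOfFin hS) := by
      rwa [Finset.range_orderEmbOfFin]
    exact ⟨s, by simp [f, hs]⟩
  have hdet : (M.submatrix f f).det ≠ 0 :=
    det_ne_zero_of_pfaffian_ne_zero (by rw [transpose_submatrix, hM]; rfl) hpf
  let r : W →ₗ[ℂ] (Fin (2 * (S.card / 2)) → ℂ) := LinearMap.funLeft ℂ ℂ f ∘ₗ W.subtype
  have hr : Function.Injective r := by
    rw [injective_iff_map_eq_zero]
    intro x hx
    ext a
    by_cases ha : a ∈ Set.range f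
    · obtain ⟨s, rfl⟩ := ha
      exact congrFun hx s
    · exact hfW x x.2 a ha
  have hiso : ∀ x ∈ LinearMap.range r, ∀ y ∈ LinearMap.range r,
      x ⬝ᵥ M.submatrix f f *ᵥ y = 0 := by
    rintro _ ⟨x, rfl⟩ _ ⟨y, rfl⟩
    exact (dotProduct_comp_submatrix_mulVec_comp hf M (hfW x x.2) (hfW y y.2)).trans
      (hW x x.2 y y.2)
  have hcard := two_mul_finrank_le_card_of_isotropic hdet hiso
  rwa [LinearMap.finrank_range_of_inj hr, Fintype.card_fin, ← hS] at hcard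

theorem finrank_le_finrank_inf_ker_add {K V V' : Type*} [Field K] [AddCommGroup V] [Module K V]
    [AddCommGroup V'] [Module K V'] [FiniteDimensional K V] [FiniteDimensional K V']
    (X : Submodule K V) (g : V →ₗ[K] V') :
    Module.finrank K X ≤
      Module.finrank K (X ⊓ LinearMap.ker g : Submodule K V) + Module.finrank K V' := by
  have hdim := g.finrank_range_add_finrank_ker
  have hrange := (LinearMap.range g).finrank_le
  have hsup := (X ⊔ LinearMap.ker g).finrank_le
  have hmod := Submodule.finrank_sup_add_finrank_inf_eq X (LinearMap.ker g)
  omega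

theorem sumElim_dotProduct_fromBlocks_mulVec_sumElim {R κ : Type*} [CommRing R] [Fintype κ]
    (A B C : Matrix κ κ R) (x x' y y' : κ → R) :
    Sum.elim x y ⬝ᵥ fromBlocks A (-Cᵀ) C B *ᵥ Sum.elim x' y' =
      x ⬝ᵥ A *ᵥ x' - y' ⬝ᵥ C *ᵥ x + (y ⬝ᵥ C *ᵥ x' + y ⬝ᵥ B *ᵥ y') := by
  rw [fromBlocks_mulVec, sumElim_dotProduct_sumElim]
  simp only [Sum.elim_comp_inl, Sum.elim_comp_inr, dotProduct_add, neg_mulVec, dotProduct_neg,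
    dotProduct_mulVec x Cᵀ, vecMul_transpose, dotProduct_comm _ y', sub_eq_add_neg]

variable {n : ℕ} {A B C : Matrix (Fin n) (Fin n) ℂ} {X Y : Submodule ℂ (Fin n → ℂ)}

theorem two_mul_finrank_add_finrank_le_card_of_pfaffianOn_ne_zero (hA : Aᵀ = -A) (hB : Bᵀ = -B)
    (hX : ∀ x ∈ X, ∀ x' ∈ X, x ⬝ᵥ A *ᵥ x' = 0) (hY : ∀ y ∈ Y, ∀ y' ∈ Y, y ⬝ᵥ B *ᵥ y' = 0)
    (hXY : ∀ x ∈ X, ∀ y ∈ Y, y ⬝ᵥ C *ᵥ x = 0) {S : Finset (Fin (n + n))}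
    (hXS : ∀ x ∈ X, ∀ a, Fin.castAdd n a ∉ S → x a = 0)
    (hYS : ∀ y ∈ Y, ∀ a, Fin.natAdd n a ∉ S → y a = 0)
    (hpf : pfaffianOn
      ((fromBlocks A (-Cᵀ) C B).submatrix finSumFinEquiv.symm finSumFinEquiv.symm) S ≠ 0) :
    2 * (Module.finrank ℂ X + Module.finrank ℂ Y) ≤ S.card := by
  let r : X × Y →ₗ[ℂ] (Fin n ⊕ Fin n → ℂ) :=
    (LinearEquiv.sumArrowLequivProdArrow (Fin n) (Fin n) ℂ ℂ).symm.toLinearMap ∘ₗ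
      X.subtype.prodMap Y.subtype
  have hr : Function.Injective r :=
    (LinearEquiv.sumArrowLequivProdArrow (Fin n) (Fin n) ℂ ℂ).symm.injective.comp
      (Subtype.val_injective.prodMap Subtype.val_injective)
  have hr_eq (z) : r z = Sum.elim (z.1 : Fin n → ℂ) (z.2 : Fin n → ℂ) := by
    ext (a | a) <;> rfl
  have hskew : (fromBlocks A (-Cᵀ) C B)ᵀ = -fromBlocks A (-Cᵀ) C B := by
    rw [fromBlocks_transpose, hA, hB, fromBlocks_neg, transpose_neg, transpose_transpose, neg_neg]
  have hsupp : ∀ w ∈ LinearMap.range r, ∀ a, finSumFinEquiv a ∉ S → w a = 0 := by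
    rintro _ ⟨⟨x, y⟩, rfl⟩ (a | a) ha
    exacts [hXS x x.2 a ha, hYS y y.2 a ha]
  have hiso : ∀ w ∈ LinearMap.range r, ∀ w' ∈ LinearMap.range r,
      w ⬝ᵥ fromBlocks A (-Cᵀ) C B *ᵥ w' = 0 := by
    rintro _ ⟨⟨x, y⟩, rfl⟩ _ ⟨⟨x', y'⟩, rfl⟩
    rw [hr_eq, hr_eq, sumElim_dotProduct_fromBlocks_mulVec_sumElim, hX _ x.2 _ x'.2,
      hXY _ x.2 _ y'.2, hXY _ x'.2 _ y.2, hY _ y.2 _ y'.2, sub_zero, add_zero, add_zero]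
  have hbound :=
    two_mul_finrank_le_card_of_pfaffianOn_ne_zero finSumFinEquiv hskew hpf hsupp hiso
  rwa [LinearMap.finrank_range_of_inj hr, Module.finrank_prod] at hbound

variable {i j : Fin n}

theorem finrank_add_finrank_le_of_pfaffianOn_ne_zero (hA : Aᵀ = -A) (hB : Bᵀ = -B)
    (hX : ∀ x ∈ X, ∀ x' ∈ X, x ⬝ᵥ A *ᵥ x' = 0) (hY : ∀ y ∈ Y, ∀ y' ∈ Y, y ⬝ᵥ B *ᵥ y' = 0)
    (hXY : ∀ x ∈ X, ∀ y ∈ Y, y ⬝ᵥ C *ᵥ x = 0) (hij : i ≠ j)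
    (hpf : pfaffianOn ((fromBlocks A (-Cᵀ) C B).submatrix finSumFinEquiv.symm finSumFinEquiv.symm)
      (Finset.univ \ {Fin.castAdd n i, Fin.castAdd n j}) ≠ 0) :
    Module.finrank ℂ X + Module.finrank ℂ Y ≤ n + 1 := by
  let g : (Fin n → ℂ) →ₗ[ℂ] ℂ × ℂ := (LinearMap.proj i).prod (LinearMap.proj j)
  have hbound := two_mul_finrank_add_finrank_le_card_of_pfaffianOn_ne_zero hA hB
    (X := X ⊓ LinearMap.ker g) (fun x hx x' hx' => hX x hx.1 x' hx'.1) hY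
    (fun x hx => hXY x hx.1)
    (fun x ⟨_, hx⟩ a ha => by
      obtain ⟨hxi, hxj⟩ := Prod.ext_iff.1 (LinearMap.mem_ker.1 hx)
      obtain rfl | rfl : a = i ∨ a = j := by
        simpa [Fin.castAdd_inj, ← or_iff_not_imp_left] using ha
      exacts [hxi, hxj])
    (fun y _ a ha => absurd ha (by
      simp only [Finset.mem_sdiff, Finset.mem_univ, true_and, Finset.mem_insert,
        Finset.mem_singleton, Fin.ext_iff, Fin.val_natAdd, Fin.val_castAdd]
      omega))
    hpf
  have hcodim := finrank_le_finrank_inf_ker_add X g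
  rw [Finset.card_univ_sdiff, Finset.card_pair (by simpa [Fin.castAdd_inj] using hij),
    Fintype.card_fin] at hbound
  rw [Module.finrank_prod, Module.finrank_self] at hcodim
  have := i.pos
  omega

theorem card_le_rank_add_one_of_pfaffianOn_ne_zero (hA : Aᵀ = -A) (hB : Bᵀ = -B)
    {K : Matrix (Fin n) (Fin n) ℂ} {P : Finset (Fin n)}
    (hKA : ∀ x x', K *ᵥ x = 0 → K *ᵥ x' = 0 → x ⬝ᵥ A *ᵥ x' = 0)
    (hKC : ∀ x, K *ᵥ x = 0 → ∀ a ∈ P, (C *ᵥ x) a = 0)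
    (hPB : ∀ a ∈ P, ∀ b ∈ P, B a b = 0) (hij : i ≠ j)
    (hpf : pfaffianOn ((fromBlocks A (-Cᵀ) C B).submatrix finSumFinEquiv.symm finSumFinEquiv.symm)
      (Finset.univ \ {Fin.castAdd n i, Fin.castAdd n j}) ≠ 0) :
    P.card ≤ K.rank + 1 := by
  have hdot {y z : Fin n → ℂ} (hy : y ∈ Pi.spanSubset ℂ (P : Set (Fin n)))
      (hz : ∀ a ∈ P, z a = 0) : y ⬝ᵥ z = 0 := by
    refine Finset.sum_eq_zero fun a _ => ?_
    by_cases ha : a ∈ P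
    · rw [hz a ha, mul_zero]
    · rw [Pi.mem_spanSubset_iff.1 hy a ha, zero_mul]
  have hbound := finrank_add_finrank_le_of_pfaffianOn_ne_zero (C := C) hA hB
    (X := LinearMap.ker K.mulVecLin) (Y := Pi.spanSubset ℂ (P : Set (Fin n)))
    (fun x hx x' hx' => hKA x x' hx hx')
    (fun y hy y' hy' => hdot hy fun a ha =>
      (dotProduct_comm _ _).trans (hdot hy' fun b hb => hPB a ha b hb))
    (fun x hx y hy => hdot hy (hKC x hx)) hij hpf
  rw [Pi.dim_spanSubset, Set.ncard_coe_finset] at hbound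
  have hker := K.mulVecLin.finrank_range_add_finrank_ker
  rw [Module.finrank_fin_fun] at hker
  unfold Matrix.rank
  omega

end Isotropic

section Commutator

variable {K ι κ : Type*} [Field K]

section Pi

variable [Finite ι] {σ : ι → K}

theorem eq_top_of_mul_mem (hσ : Function.Injective σ) {L : Submodule K (ι → K)}
    (hL : ∀ x ∈ L, σ * x ∈ L) {y : ι → K} (hyL : y ∈ L) (hy : ∀ a, y a ≠ 0) : L = ⊤ := by
  classical
  have := Fintype.ofFinite ι
  refine (Submodule.eq_top_iff').2 fun x => ?_
  -- multiplication by an arbitrary vector is a polynomial in multiplication by `σ`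
  let f : Polynomial K := Lagrange.interpolate Finset.univ σ (x / y)
  have hf : Polynomial.aeval σ f • y ∈ L :=
    Polynomial.aeval_apply_smul_mem_of_le_comap' hyL f σ hL
  convert hf
  ext a
  rw [smul_eq_mul, Pi.mul_apply, Polynomial.aeval_pi_apply₂, Polynomial.coe_aeval_eq_eval,
    Lagrange.eval_interpolate_at_node _ hσ.injOn (Finset.mem_univ a), Pi.div_apply,
    div_mul_cancel₀ _ (hy a)]

theorem lt_of_mul_mem (hσ : Function.Injective σ) {L N : Submodule K (ι → K)} (hLN : L ≤ N)
    (hσL : ∀ x ∈ L, σ * x ∈ N) (hL : L ≠ ⊤) {y : ι → K} (hyN : y ∈ N) (hy : ∀ a, y a ≠ 0) :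
    L < N := by
  refine lt_of_le_of_ne hLN ?_
  rintro rfl
  exact hL (eq_top_of_mul_mem hσ hσL hyN hy)

theorem two_le_finrank_of_mul_mem [Nontrivial ι] (hσ : Function.Injective σ)
    {N : Submodule K (ι → K)} {y : ι → K} (hy : ∀ a, y a ≠ 0) (hyN : y ∈ N) (hσy : σ * y ∈ N) :
    2 ≤ Module.finrank K N := by
  obtain ⟨a, b, hab⟩ := exists_pair_ne ι
  have hli : LinearIndependent K ![y, σ * y] := by
    refine (LinearIndependent.pair_iff' fun h => hy a (congrFun h a)).2 fun c hc => hab (hσ ?_)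
    have hσc (i : ι) : c = σ i := mul_right_cancel₀ (hy i) (congrFun hc i)
    rw [← hσc a, ← hσc b]
  have hspan : Submodule.span K (Set.range ![y, σ * y]) ≤ N := by
    rw [Submodule.span_le, range_cons_cons_empty, Set.pair_subset_iff]
    exact ⟨hyN, hσy⟩
  simpa [finrank_span_eq_card hli] using Submodule.finrank_mono hspan

end Pi

variable [Fintype ι]

theorem eq_zero_of_ker_mulVecLin_eq_top {R μ : Type*} [CommSemiring R] {M : Matrix μ ι R}
    (hM : LinearMap.ker M.mulVecLin = ⊤) : M = 0 := by
  classical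
  exact toLin'.map_eq_zero_iff.1 (LinearMap.ker_eq_top.1 hM)

variable [Fintype κ] {S T : Matrix ι ι K} {U V : Matrix ι κ K} {p q : κ → K}

theorem range_sup_range_le_ker {μ : Type*} {M : Matrix μ ι K} (hMS : M * S = 0) (hMV : M * V = 0) :
    LinearMap.range S.mulVecLin ⊔ LinearMap.range V.mulVecLin ≤ LinearMap.ker M.mulVecLin := by
  refine sup_le (LinearMap.range_le_ker_iff.2 ?_) (LinearMap.range_le_ker_iff.2 ?_)
  · rw [← mulVecLin_mul, hMS, mulVecLin_zero]
  · rw [← mulVecLin_mul, hMV, mulVecLin_zero]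

theorem nontrivial_of_transpose_mul_eq_zero [Nonempty ι] (hUV : Uᵀ * V = 0)
    (hp : ∀ a, (U *ᵥ p) a ≠ 0) (hq : ∀ a, (V *ᵥ q) a ≠ 0) : Nontrivial ι := by
  by_contra hι
  rw [not_nontrivial_iff_subsingleton] at hι
  obtain ⟨a⟩ := ‹Nonempty ι›
  have hdot : (U *ᵥ p) ⬝ᵥ (V *ᵥ q) = 0 := by
    rw [← vecMul_transpose, ← dotProduct_mulVec, mulVec_mulVec, hUV, zero_mulVec, dotProduct_zero]
  rw [dotProduct, Fintype.sum_subsingleton _ a] at hdot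
  exact mul_ne_zero (hp a) (hq a) hdot

variable [DecidableEq ι] {σ : ι → K} {X Y : Matrix κ ι K}

theorem diagonal_mulVec_eq_mul (x : ι → K) : diagonal σ *ᵥ x = σ * x :=
  funext fun a => mulVec_diagonal σ x a

theorem mulVec_mul_eq_zero_of_commutator (hT : diagonal σ * T - T * diagonal σ = U * X)
    {x : ι → K} (hTx : T *ᵥ x = 0) (hXx : X *ᵥ x = 0) : T *ᵥ (σ * x) = 0 := by
  have hcomm := congrArg (· *ᵥ x) hT
  simp only [sub_mulVec, ← mulVec_mulVec, hTx, hXx, mulVec_zero, zero_sub, neg_eq_zero,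
    diagonal_mulVec_eq_mul] at hcomm
  exact hcomm

theorem eq_zero_of_commute_diagonal (hσ : Function.Injective σ) {M : Matrix ι ι K}
    (hM : Commute (diagonal σ) M) {y : ι → K} (hMy : M *ᵥ y = 0) (hy : ∀ a, y a ≠ 0) : M = 0 := by
  refine eq_zero_of_ker_mulVecLin_eq_top (eq_top_of_mul_mem hσ (fun x hx => ?_) hMy hy)
  rw [LinearMap.mem_ker, mulVecLin_apply] at hx ⊢
  rw [← diagonal_mulVec_eq_mul, mulVec_mulVec, ← hM.eq, ← mulVec_mulVec, hx, mulVec_zero]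

theorem mul_eq_zero_of_commutator (hσ : Function.Injective σ)
    (hT : diagonal σ * T - T * diagonal σ = U * X) (hS : diagonal σ * S - S * diagonal σ = V * Y)
    (hXS : X * S = 0) (hTV : T * V = 0) {y : ι → K} (hSy : S *ᵥ y = 0) (hy : ∀ a, y a ≠ 0) :
    T * S = 0 := by
  have hcomm : diagonal σ * (T * S) = T * S * diagonal σ :=
    calc diagonal σ * (T * S) = (T * diagonal σ + U * X) * S := by
          rw [← hT, add_sub_cancel, Matrix.mul_assoc]
      _ = T * (diagonal σ * S) := by
          rw [Matrix.add_mul, Matrix.mul_assoc U, hXS, Matrix.mul_zero, add_zero, Matrix.mul_assoc]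
      _ = T * (S * diagonal σ + V * Y) := by rw [← hS, add_sub_cancel]
      _ = T * S * diagonal σ := by
          rw [Matrix.mul_add, ← Matrix.mul_assoc T V, hTV, Matrix.zero_mul, add_zero,
            Matrix.mul_assoc]
  refine eq_zero_of_commute_diagonal hσ hcomm ?_ hy
  rw [← mulVec_mulVec, hSy, mulVec_zero]

theorem rank_lt_finrank_range_sup_range (hσ : Function.Injective σ)
    (hS : diagonal σ * S - S * diagonal σ = V * Y) (hdet : S.det = 0)
    (hq : ∀ a, (V *ᵥ q) a ≠ 0) :
    S.rank < Module.finrank K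
      (LinearMap.range S.mulVecLin ⊔ LinearMap.range V.mulVecLin : Submodule K (ι → K)) := by
  refine Submodule.finrank_lt_finrank_of_lt (lt_of_mul_mem hσ le_sup_left ?_ ?_
    (Submodule.mem_sup_right ⟨q, rfl⟩) hq)
  · rintro _ ⟨x, rfl⟩
    have hcomm : σ * S *ᵥ x = S *ᵥ (σ * x) + V *ᵥ (Y *ᵥ x) := by
      rw [← diagonal_mulVec_eq_mul, ← diagonal_mulVec_eq_mul, mulVec_mulVec, mulVec_mulVec,
        mulVec_mulVec, ← hS, sub_mulVec, add_sub_cancel]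
    rw [mulVecLin_apply, hcomm]
    exact Submodule.add_mem_sup ⟨_, rfl⟩ ⟨_, rfl⟩
  · intro htop
    obtain ⟨B, hB⟩ := mulVec_surjective_iff_exists_right_inverse.1 (LinearMap.range_eq_top.1 htop)
    simpa [hdet] using congrArg det hB

theorem range_sup_range_lt_ker (hσ : Function.Injective σ)
    (hT : diagonal σ * T - T * diagonal σ = U * X) (hXS : X * S = 0) (hXV : X * V = 0)
    (hTS : T * S = 0) (hTV : T * V = 0) (hT0 : T ≠ 0) (hq : ∀ a, (V *ᵥ q) a ≠ 0) :
    LinearMap.range S.mulVecLin ⊔ LinearMap.range V.mulVecLin < LinearMap.ker T.mulVecLin := by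
  have hle := range_sup_range_le_ker hTS hTV
  refine lt_of_mul_mem hσ hle (fun x hx => ?_) (fun htop => hT0 ?_)
    (hle (Submodule.mem_sup_right ⟨q, rfl⟩)) hq
  · exact mulVec_mul_eq_zero_of_commutator hT (hle hx) (range_sup_range_le_ker hXS hXV hx)
  · exact eq_zero_of_ker_mulVecLin_eq_top (top_le_iff.1 (htop.ge.trans hle))

theorem rank_add_rank_add_two_le_card [Nonempty ι] {J J' : Matrix κ κ K}
    (hσ : Function.Injective σ) (hT : diagonal σ * T - T * diagonal σ = U * (J * Uᵀ))
    (hS : diagonal σ * S - S * diagonal σ = V * (J' * Vᵀ)) (hSt : Sᵀ = S) (hSU : S * U = 0)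
    (hTV : T * V = 0) (hUV : Uᵀ * V = 0) (hp : ∀ a, (U *ᵥ p) a ≠ 0)
    (hq : ∀ a, (V *ᵥ q) a ≠ 0) : S.rank + T.rank + 2 ≤ Fintype.card ι := by
  have hdimS := S.mulVecLin.finrank_range_add_finrank_ker
  have hdimT := T.mulVecLin.finrank_range_add_finrank_ker
  rw [Module.finrank_fintype_fun_eq_card] at hdimS hdimT
  have hSUp : S *ᵥ (U *ᵥ p) = 0 := by rw [mulVec_mulVec, hSU, zero_mulVec]
  by_cases hT0 : T = 0
  · have : Nontrivial ι := nontrivial_of_transpose_mul_eq_zero hUV hp hq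
    have hVU : Vᵀ * U = 0 := by rw [← transpose_transpose U, ← transpose_mul, hUV, transpose_zero]
    have hYUp : (J' * Vᵀ) *ᵥ (U *ᵥ p) = 0 := by
      rw [mulVec_mulVec, Matrix.mul_assoc, hVU, Matrix.mul_zero, zero_mulVec]
    have hSσUp := mulVec_mul_eq_zero_of_commutator hS hSUp hYUp
    have hker := two_le_finrank_of_mul_mem hσ hp (N := LinearMap.ker S.mulVecLin) hSUp hSσUp
    rw [hT0, rank_zero]
    unfold Matrix.rank
    omega
  · have hdet : S.det = 0 := exists_mulVec_eq_zero_iff.1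
      ⟨U *ᵥ p, fun h => hp (Classical.arbitrary ι) (congrFun h _), hSUp⟩
    have hUS : Uᵀ * S = 0 := by rw [← hSt, ← transpose_mul, hSU, transpose_zero]
    have hXS : J * Uᵀ * S = 0 := by rw [Matrix.mul_assoc, hUS, Matrix.mul_zero]
    have hXV : J * Uᵀ * V = 0 := by rw [Matrix.mul_assoc, hUV, Matrix.mul_zero]
    have hTS := mul_eq_zero_of_commutator hσ hT hS hXS hTV hSUp hp
    have hlt := rank_lt_finrank_range_sup_range hσ hS hdet hq
    have hlt' := Submodule.finrank_lt_finrank_of_lt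
      (range_sup_range_lt_ker hσ hT hXS hXV hTS hTV hT0 hq)
    unfold Matrix.rank at *
    omega

end Commutator

section Brackets

/-- The matrix `J` of the bilinear form `angle`, so that the matrix of all angle brackets of a
family of spinors with matrix `U` is `U * (J * Uᵀ)`. -/
def leviCivita : Matrix (Fin 2) (Fin 2) ℂ := !![0, 1; -1, 0]

theorem angle_eq_dotProduct (x y : Spinor) : angle x y = x ⬝ᵥ leviCivita *ᵥ y := by
  simp only [angle, leviCivita, dotProduct, mulVec, Fin.sum_univ_two, of_apply, cons_val',
    cons_val_fin_one, cons_val_zero, cons_val_one]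
  ring

theorem square_eq_neg_angle (x y : Spinor) : square x y = -angle x y := by
  simp only [square, angle]
  ring

theorem square_ne_zero_iff {x y : Spinor} : square x y ≠ 0 ↔ angle x y ≠ 0 := by
  rw [square_eq_neg_angle, neg_ne_zero]

theorem angle_self (x : Spinor) : angle x x = 0 := by
  simp only [angle]
  ring

theorem square_self (x : Spinor) : square x x = 0 := by
  rw [square_eq_neg_angle, angle_self, neg_zero]

theorem neg_angle (x y : Spinor) : -angle x y = angle y x := by
  simp only [angle]
  ring

theorem neg_square (x y : Spinor) : -square x y = square y x := by
  simp only [square]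
  ring

theorem schouten (x y z w : Spinor) :
    square z w * square x y = square x w * square z y - square z x * square y w := by
  simp only [square]
  ring

theorem eq_zero_of_square_eq_zero {w x y : Spinor} (hxy : square x y ≠ 0) (hx : square w x = 0)
    (hy : square w y = 0) : w = 0 := by
  simp only [square] at *
  ext s
  refine (mul_eq_zero.1 (?_ : (x 1 * y 0 - x 0 * y 1) * w s = 0)).resolve_left hxy
  fin_cases s <;> simp only [Fin.zero_eta, Fin.mk_one, Fin.isValue]
  · linear_combination (x 0) * hy - (y 0) * hx
  · linear_combination (x 1) * hy - (y 1) * hx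

theorem exists_forall_angle_eq_apply (s : Fin 2) : ∃ z : Spinor, ∀ x : Spinor, angle x z = x s := by
  fin_cases s
  · exact ⟨![0, 1], fun x => by simp [angle]⟩
  · exact ⟨![-1, 0], fun x => by simp [angle]⟩

theorem square_mul_of_apply {ι κ : Type*} [Fintype κ] (M : Matrix ι κ ℂ) (f : κ → Spinor)
    (z : Spinor) (a : ι) : square ((M * of f) a) z = (M *ᵥ fun b => square (f b) z) a := by
  simp only [square, Matrix.mul_apply, of_apply, mulVec, dotProduct, Finset.sum_mul,
    ← Finset.sum_sub_distrib]
  exact Finset.sum_congr rfl fun _ _ => by ring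

end Brackets

section Vectors

theorem mdot_comm (u v : FourVec) : mdot u v = mdot v u := by
  simp only [mdot]
  ring

theorem mdot_smul_left (c : ℂ) (u v : FourVec) : mdot (c • u) v = c * mdot u v := by
  simp only [mdot, Pi.smul_apply, smul_eq_mul]
  ring

theorem mdot_smul_right (c : ℂ) (u v : FourVec) : mdot u (c • v) = c * mdot u v := by
  rw [mdot_comm, mdot_smul_left, mdot_comm]

theorem mdot_sum_left {ι : Type*} (s : Finset ι) (u : ι → FourVec) (v : FourVec) :
    mdot (∑ a ∈ s, u a) v = ∑ a ∈ s, mdot (u a) v := by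
  simp only [mdot, Finset.sum_apply, Finset.sum_mul, Finset.sum_sub_distrib]

/-- The reflection of a four-vector that exchanges angle and square spinors; only the component
along `σ₂`, the antisymmetric Pauli matrix, changes sign. -/
def parity (v : FourVec) : FourVec := ![v 0, v 1, -v 2, v 3]

theorem parity_smul (c : ℂ) (v : FourVec) : parity (c • v) = c • parity v := by
  simp [parity]

theorem parity_sum {ι : Type*} (s : Finset ι) (v : ι → FourVec) :
    parity (∑ a ∈ s, v a) = ∑ a ∈ s, parity (v a) := by
  ext μ
  fin_cases μ <;> simp [parity]

theorem mdot_parity (u v : FourVec) : mdot (parity u) (parity v) = mdot u v := by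
  simp [mdot, parity]

theorem sandwich_swap (x y : Spinor) : sandwich y x = parity (sandwich x y) := by
  ext μ
  fin_cases μ <;> simp [sandwich, parity, pauli, dotProduct, mulVec, Fin.sum_univ_two] <;> ring

end Vectors

section Kinematics

variable {n : ℕ} (lam lamT : Fin n → Spinor) (p q : Spinor) (neg : Finset (Fin n))
  (σ : Fin n → ℂ) (a b : Fin n)

theorem mandelstam_eq_neg_angle_mul_square :
    mandelstam lam lamT a b = -(angle (lam a) (lam b) * square (lamT a) (lamT b)) := by
  rw [mandelstam, momentum, momentum, mdot_smul_left, mdot_smul_right, mdot_sandwich,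
    ← neg_square (lamT a)]
  ring

variable {lam lamT} in
theorem transpose_of_mul_of_eq_zero (hmom : ∑ a, momentum lam lamT a = 0) :
    (of lam)ᵀ * of lamT = 0 := by
  ext s t
  obtain ⟨z, hz⟩ := exists_forall_angle_eq_apply s
  obtain ⟨w, hw⟩ := exists_forall_angle_eq_apply t
  calc ∑ a, lam a s * lamT a t = ∑ a, mdot (momentum lam lamT a) (sandwich z w) :=
        Finset.sum_congr rfl fun a _ => by
          rw [momentum, mdot_smul_left, mdot_sandwich, hz, ← neg_square, square_eq_neg_angle, hw]
          ring
    _ = 0 := by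
      rw [← mdot_sum_left, hmom]
      simp [mdot]

section Parity

theorem momentum_swap : momentum lamT lam a = parity (momentum lam lamT a) := by
  rw [momentum, momentum, sandwich_swap, parity_smul]

variable {lam lamT} in
theorem sum_momentum_swap (hmom : ∑ a, momentum lam lamT a = 0) :
    ∑ a, momentum lamT lam a = 0 := by
  simp only [momentum_swap lam lamT, ← parity_sum, hmom]
  simp [parity]

theorem mandelstam_swap : mandelstam lamT lam a b = mandelstam lam lamT a b := by
  rw [mandelstam, momentum_swap lam, momentum_swap lam, mdot_parity, mandelstam]

theorem isSolution_swap : IsSolution lamT lam σ ↔ IsSolution lam lamT σ := by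
  simp only [IsSolution, mandelstam_swap lam lamT]

theorem polarization_swap :
    polarization lamT lam q p negᶜ a = (-1 : ℂ) • parity (polarization lam lamT p q neg a) := by
  by_cases ha : a ∈ neg
  · rw [polarization, polarization, if_neg (by simpa using ha), if_pos ha, sandwich_swap,
      parity_smul, smul_smul, square_eq_neg_angle]
    congr 1
    ring
  · rw [polarization, polarization, if_pos (by simpa using ha), if_neg ha, sandwich_swap,
      parity_smul, smul_smul, square_eq_neg_angle]
    congr 1
    ring

theorem blockA_swap : blockA lamT lam σ = blockA lam lamT σ := by
  simp only [blockA, mandelstam_swap lam lamT]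

theorem blockB_swap : blockB lamT lam q p negᶜ σ = blockB lam lamT p q neg σ := by
  simp only [blockB, polarization_swap, mdot_smul_left, mdot_smul_right, mdot_parity, neg_mul,
    one_mul, neg_neg]

theorem blockC_swap : blockC lamT lam q p negᶜ σ = -blockC lam lamT p q neg σ := by
  ext a b
  simp only [blockC, polarization_swap, momentum_swap lam lamT, mdot_smul_left, mdot_parity,
    neg_mul, one_mul, mul_neg, neg_div, Finset.sum_neg_distrib, of_apply, Matrix.neg_apply,
    neg_neg]
  split_ifs
  · rfl
  · rw [neg_neg]

theorem discPlus_eq_neg_discMinus_swap :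
    discPlus lam lamT p σ = -discMinus lamT lam p σ := by
  ext a b
  by_cases h : a = b
  · simp only [discPlus, discMinus, of_apply, Matrix.neg_apply, if_pos h, square_eq_neg_angle,
      mul_neg, neg_mul, neg_div_neg_eq]
    simp only [neg_div, Finset.sum_neg_distrib]
  · simp only [discPlus, discMinus, of_apply, Matrix.neg_apply, if_neg h, square_eq_neg_angle,
      neg_div]

theorem rank_discPlus : (discPlus lam lamT p σ).rank = (discMinus lamT lam p σ).rank := by
  rw [discPlus_eq_neg_discMinus_swap, ← neg_one_smul ℂ]
  exact rank_smul_of_mem_nonZeroDivisors _ (by simp)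

theorem PPlus_eq_PMinus_swap (m : ℤ) : PPlus lam lamT p m = PMinus lamT lam p m := by
  simp only [PPlus, PMinus, rank_discPlus, isSolution_swap lam lamT]

end Parity

section Discriminant

theorem discMinus_transpose : (discMinus lam lamT q σ)ᵀ = discMinus lam lamT q σ := by
  ext a b
  by_cases h : a = b
  · rw [h, transpose_apply]
  · simp only [transpose_apply, discMinus, of_apply, if_neg h, if_neg (Ne.symm h)]
    rw [← neg_angle (lam a), ← neg_sub (σ a), neg_div_neg_eq]

variable {σ a b}

theorem discMinus_commutator (hσ : Function.Injective σ) :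
    diagonal σ * discMinus lam lamT q σ - discMinus lam lamT q σ * diagonal σ =
      of lam * (leviCivita * (of lam)ᵀ) := by
  ext a b
  rw [Matrix.sub_apply, diagonal_mul, mul_diagonal, mul_comm _ (σ b), ← sub_mul]
  change _ = lam a ⬝ᵥ leviCivita *ᵥ lam b
  rw [← angle_eq_dotProduct]
  by_cases h : a = b
  · rw [h, sub_self, zero_mul, angle_self]
  · rw [discMinus, of_apply, if_neg h, mul_div_cancel₀ _ (sub_ne_zero.2 (hσ.ne h))]

variable {lam lamT p q}

theorem discMinus_mulVec_reference (hq : ∀ a, square (lamT a) q ≠ 0) (hσ : Function.Injective σ) :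
    discMinus lam lamT q σ *ᵥ (fun b => square (lamT b) q) = 0 := by
  ext a
  rw [mulVec, dotProduct, ← Finset.add_sum_erase _ _ (Finset.mem_univ a), discMinus, of_apply,
    if_pos rfl, neg_mul, Finset.sum_mul, Pi.zero_apply, neg_add_eq_zero]
  refine Finset.sum_congr rfl fun b hb => ?_
  have hab := Finset.ne_of_mem_erase hb
  have hσab := sub_ne_zero.2 (hσ.ne hab.symm)
  have hqa := hq a
  rw [of_apply, if_neg hab.symm]
  field_simp

theorem discMinus_mulVec_square_self (hsol : IsSolution lam lamT σ) :
    (discMinus lam lamT q σ *ᵥ fun b => square (lamT b) (lamT a)) a = 0 := by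
  rw [mulVec, dotProduct, ← Finset.add_sum_erase _ _ (Finset.mem_univ a), square_self, mul_zero,
    zero_add, ← hsol.2 a]
  refine Finset.sum_congr rfl fun b hb => ?_
  rw [discMinus, of_apply, if_neg (Finset.ne_of_mem_erase hb).symm,
    mandelstam_eq_neg_angle_mul_square, ← neg_square (lamT a)]
  ring

theorem discMinus_mul_of_lamT (hq : ∀ a, square (lamT a) q ≠ 0) (hsol : IsSolution lam lamT σ) :
    discMinus lam lamT q σ * of lamT = 0 :=
  funext fun a => eq_zero_of_square_eq_zero (hq a)
    ((square_mul_of_apply _ _ _ a).trans (discMinus_mulVec_square_self hsol))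
    ((square_mul_of_apply _ _ _ a).trans (congrFun (discMinus_mulVec_reference hq hsol.1) a))

theorem rank_discPlus_add_rank_discMinus_add_two_le [Nonempty (Fin n)]
    (hmom : ∑ a, momentum lam lamT a = 0) (hp : ∀ a, angle (lam a) p ≠ 0)
    (hq : ∀ a, square (lamT a) q ≠ 0) (hsol : IsSolution lam lamT σ) :
    (discPlus lam lamT p σ).rank + (discMinus lam lamT q σ).rank + 2 ≤ n := by
  have hpl (a) : (of lam *ᵥ leviCivita *ᵥ p) a ≠ 0 :=
    (angle_eq_dotProduct (lam a) p).symm.trans_ne (hp a)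
  have hql (a) : (of lamT *ᵥ leviCivita *ᵥ q) a ≠ 0 :=
    (angle_eq_dotProduct (lamT a) q).symm.trans_ne (square_ne_zero_iff.1 (hq a))
  have h := rank_add_rank_add_two_le_card hsol.1 (discMinus_commutator lam lamT q hsol.1)
    (discMinus_commutator lamT lam p hsol.1) (discMinus_transpose lamT lam p σ)
    (discMinus_mul_of_lamT (fun a => square_ne_zero_iff.2 (hp a)) ((isSolution_swap ..).2 hsol))
    (discMinus_mul_of_lamT hq hsol) (transpose_of_mul_of_eq_zero hmom) hpl hql
  rwa [Fintype.card_fin, ← rank_discPlus] at h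

variable (lamT q) in
theorem one_le_rank_discMinus (hσ : Function.Injective σ) (hab : angle (lam a) (lam b) ≠ 0) :
    1 ≤ (discMinus lam lamT q σ).rank := by
  have hne : a ≠ b := by
    rintro rfl
    exact hab (angle_self _)
  have hentry : discMinus lam lamT q σ a b ≠ 0 := by
    rw [discMinus, of_apply, if_neg hne]
    exact div_ne_zero hab (sub_ne_zero.2 (hσ.ne hne))
  rw [Nat.one_le_iff_ne_zero]
  intro hrank
  have hker : LinearMap.ker (discMinus lam lamT q σ).mulVecLin = ⊤ :=
    LinearMap.ker_eq_top.2 (LinearMap.range_eq_bot.1 (Submodule.finrank_eq_zero.1 hrank))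
  exact hentry (congrFun₂ (eq_zero_of_ker_mulVecLin_eq_top hker) a b)

end Discriminant

section Polarizations

theorem blockA_transpose : (blockA lam lamT σ)ᵀ = -blockA lam lamT σ := by
  ext a b
  by_cases h : a = b
  · simp [blockA, h]
  · simp only [blockA, transpose_apply, Matrix.neg_apply, of_apply, if_neg h,
      if_neg (Ne.symm h), mandelstam]
    rw [mdot_comm, ← neg_sub (σ a), div_neg]

theorem blockB_transpose :
    (blockB lam lamT p q neg σ)ᵀ = -blockB lam lamT p q neg σ := by
  ext a b
  by_cases h : a = b
  · simp [blockB, h]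
  · simp only [blockB, transpose_apply, Matrix.neg_apply, of_apply, if_neg h, if_neg (Ne.symm h)]
    rw [mdot_comm, ← neg_sub (σ a), div_neg]

/-- The matrix `𝔆₋` with column `b` multiplied by `[bq]`. Its kernel is isotropic for the block `A`
of `Ψ`, and its rows are proportional to those of the block `C` at negative-helicity particles. -/
noncomputable def scaledDiscMinus : Matrix (Fin n) (Fin n) ℂ :=
  discMinus lam lamT q σ * diagonal fun b => square (lamT b) q

theorem rank_scaledDiscMinus_le :
    (scaledDiscMinus lam lamT q σ).rank ≤ (discMinus lam lamT q σ).rank :=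
  rank_mul_le_left _ _

theorem square_smul_blockA (z : Spinor) :
    square z q • blockA lam lamT σ =
      diagonal (fun a => square z (lamT a)) * scaledDiscMinus lam lamT q σ -
        (scaledDiscMinus lam lamT q σ)ᵀ * diagonal fun a => square z (lamT a) := by
  ext a b
  rw [Matrix.smul_apply, smul_eq_mul, Matrix.sub_apply, diagonal_mul, mul_diagonal,
    transpose_apply, scaledDiscMinus, mul_diagonal, mul_diagonal,
    ← congrFun₂ (discMinus_transpose lam lamT q σ) b a, transpose_apply]
  by_cases hab : a = b
  · simp only [hab, blockA, of_apply, if_pos]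
    ring
  · rw [blockA, discMinus, of_apply, of_apply, if_neg hab, if_neg hab,
      mandelstam_eq_neg_angle_mul_square]
    linear_combination (-(angle (lam a) (lam b) / (σ a - σ b))) *
      schouten (lamT a) (lamT b) z q

variable {lam lamT p q neg σ a}

theorem dotProduct_blockA_mulVec_eq_zero {z : Spinor} (hz : square z q ≠ 0) {x x' : Fin n → ℂ}
    (hx : scaledDiscMinus lam lamT q σ *ᵥ x = 0) (hx' : scaledDiscMinus lam lamT q σ *ᵥ x' = 0) :
    x ⬝ᵥ blockA lam lamT σ *ᵥ x' = 0 := by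
  refine (mul_eq_zero.1 ?_).resolve_left hz
  rw [← smul_eq_mul, ← dotProduct_smul, ← smul_mulVec, square_smul_blockA, sub_mulVec,
    ← mulVec_mulVec, ← mulVec_mulVec, hx', mulVec_zero, zero_sub, dotProduct_neg,
    dotProduct_mulVec, vecMul_transpose, hx, zero_dotProduct, neg_zero]

theorem mdot_polarization_of_mem (ha : a ∈ neg) (hb : b ∈ neg) :
    mdot (polarization lam lamT p q neg a) (polarization lam lamT p q neg b) = 0 := by
  simp only [polarization, if_pos ha, if_pos hb, mdot_smul_left, mdot_smul_right, mdot_sandwich,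
    square_self, mul_zero]

theorem blockB_of_mem (ha : a ∈ neg) (hb : b ∈ neg) : blockB lam lamT p q neg σ a b = 0 := by
  simp only [blockB, of_apply, mdot_polarization_of_mem b ha hb, zero_div, ite_self]

theorem sqrt_two_mul_mdot_polarization_momentum_of_mem (ha : a ∈ neg) :
    (Real.sqrt 2 : ℂ) * mdot (polarization lam lamT p q neg a) (momentum lam lamT b) =
      -(angle (lam a) (lam b) * square (lamT b) q / square (lamT a) q) := by
  have hsqrt : (Real.sqrt 2 : ℂ) ≠ 0 := by simp
  simp only [polarization, if_pos ha, momentum, mdot_smul_left, mdot_smul_right, mdot_sandwich]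
  rw [← neg_square (lamT a)]
  field_simp

theorem blockC_of_mem (hqa : square (lamT a) q ≠ 0) (ha : a ∈ neg) :
    blockC lam lamT p q neg σ a b = (square (lamT a) q)⁻¹ * scaledDiscMinus lam lamT q σ a b := by
  rw [scaledDiscMinus, mul_diagonal]
  by_cases hab : a = b
  · subst hab
    simp only [blockC, discMinus, of_apply, if_true,
      sqrt_two_mul_mdot_polarization_momentum_of_mem _ ha]
    rw [mul_comm (-_), inv_mul_cancel_left₀ hqa, ← Finset.sum_neg_distrib]
    refine Finset.sum_congr rfl fun c _ => ?_
    rw [neg_div, div_div, mul_comm (square (lamT a) q)]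
  · simp only [blockC, discMinus, of_apply, if_neg hab,
      sqrt_two_mul_mdot_polarization_momentum_of_mem _ ha]
    ring

theorem blockC_mulVec_eq_zero (hqa : square (lamT a) q ≠ 0) (ha : a ∈ neg) {x : Fin n → ℂ}
    (hx : scaledDiscMinus lam lamT q σ *ᵥ x = 0) : (blockC lam lamT p q neg σ *ᵥ x) a = 0 := by
  have hrow : blockC lam lamT p q neg σ a =
      (square (lamT a) q)⁻¹ • scaledDiscMinus lam lamT q σ a :=
    funext fun b => blockC_of_mem b hqa ha
  rw [mulVec, hrow, smul_dotProduct]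
  exact smul_eq_zero_of_right _ (congrFun hx a)

end Polarizations

section Support

variable {lam lamT p q neg σ} {i j : Fin n} {k : ℤ}

theorem card_neg_le_rank_discMinus_add_one (hq : ∀ a, square (lamT a) q ≠ 0) (hij : i ≠ j)
    (hpf : reducedPf lam lamT p q neg σ i j ≠ 0) :
    neg.card ≤ (discMinus lam lamT q σ).rank + 1 :=
  (card_le_rank_add_one_of_pfaffianOn_ne_zero (blockA_transpose lam lamT σ)
    (blockB_transpose lam lamT p q neg σ)
    (fun _ _ hx hx' => dotProduct_blockA_mulVec_eq_zero (hq i) hx hx')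
    (fun _ hx _ ha => blockC_mulVec_eq_zero (hq _) ha hx)
    (fun _ ha _ hb => blockB_of_mem _ ha hb) hij (right_ne_zero_of_mul hpf)).trans
    (Nat.succ_le_succ (rank_scaledDiscMinus_le lam lamT q σ))

theorem card_compl_neg_le_rank_discPlus_add_one (hp : ∀ a, angle (lam a) p ≠ 0) (hij : i ≠ j)
    (hpf : reducedPf lam lamT p q neg σ i j ≠ 0) :
    negᶜ.card ≤ (discPlus lam lamT p σ).rank + 1 := by
  have hp' (a : Fin n) : square (lam a) p ≠ 0 := square_ne_zero_iff.2 (hp a)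
  rw [rank_discPlus]
  refine (card_le_rank_add_one_of_pfaffianOn_ne_zero (blockA_transpose lam lamT σ)
    (blockB_transpose lam lamT p q neg σ) (K := scaledDiscMinus lamT lam p σ)
    (fun x x' hx hx' => ?_) (fun x hx a ha => ?_) (fun a ha b hb => ?_) hij
    (right_ne_zero_of_mul hpf)).trans (Nat.succ_le_succ (rank_scaledDiscMinus_le lamT lam p σ))
  · rw [← blockA_swap]
    exact dotProduct_blockA_mulVec_eq_zero (hp' i) hx hx'
  · have hC := blockC_mulVec_eq_zero (p := q) (hp' a) ha hx
    rwa [blockC_swap, neg_mulVec, Pi.neg_apply, neg_eq_zero] at hC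
  · rw [← blockB_swap]
    exact blockB_of_mem b ha hb

theorem rank_add_one_eq_card_of_reducedPf_ne_zero (hmom : ∑ a, momentum lam lamT a = 0)
    (hp : ∀ a, angle (lam a) p ≠ 0) (hq : ∀ a, square (lamT a) q ≠ 0)
    (hsol : IsSolution lam lamT σ) (hij : i ≠ j) (hpf : reducedPf lam lamT p q neg σ i j ≠ 0) :
    (discMinus lam lamT q σ).rank + 1 = neg.card ∧
      (discPlus lam lamT p σ).rank + 1 = negᶜ.card := by
  have : Nonempty (Fin n) := ⟨i⟩
  have hneg := card_neg_le_rank_discMinus_add_one hq hij hpf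
  have hpos := card_compl_neg_le_rank_discPlus_add_one hp hij hpf
  have hrank := rank_discPlus_add_rank_discMinus_add_two_le hmom hp hq hsol
  have hcard := Finset.card_add_card_compl neg
  rw [Fintype.card_fin] at hcard
  omega

theorem mem_PMinus_of_reducedPf_ne_zero (hmom : ∑ a, momentum lam lamT a = 0)
    (hp : ∀ a, angle (lam a) p ≠ 0) (hq : ∀ a, square (lamT a) q ≠ 0)
    (hsol : IsSolution lam lamT σ) (hneg : IsNkMHV neg k) (hij : i ≠ j)
    (hpf : reducedPf lam lamT p q neg σ i j ≠ 0) : σ ∈ PMinus lam lamT q k := by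
  have hrank := (rank_add_one_eq_card_of_reducedPf_ne_zero hmom hp hq hsol hij hpf).1
  rw [IsNkMHV] at hneg
  exact ⟨hsol, by omega⟩

theorem mem_PPlus_of_reducedPf_ne_zero (hmom : ∑ a, momentum lam lamT a = 0)
    (hp : ∀ a, angle (lam a) p ≠ 0) (hq : ∀ a, square (lamT a) q ≠ 0)
    (hsol : IsSolution lam lamT σ) (hneg : IsNkMHV neg (n - k - 4)) (hij : i ≠ j)
    (hpf : reducedPf lam lamT p q neg σ i j ≠ 0) : σ ∈ PPlus lam lamT p k := by
  have hrank := (rank_add_one_eq_card_of_reducedPf_ne_zero hmom hp hq hsol hij hpf).2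
  have hcard := Finset.card_add_card_compl neg
  rw [Fintype.card_fin] at hcard
  rw [IsNkMHV] at hneg
  exact ⟨hsol, by omega⟩

theorem reducedPf_ne_zero_of_integrandYM_ne_zero
    (h : integrandYM lam lamT p q neg σ i j ≠ 0) : reducedPf lam lamT p q neg σ i j ≠ 0 :=
  right_ne_zero_of_mul (div_ne_zero_iff.1 h).1

theorem reducedPf_ne_zero_of_integrandGravity_ne_zero
    (h : integrandGravity lam lamT p q neg σ i j ≠ 0) : reducedPf lam lamT p q neg σ i j ≠ 0 :=
  right_ne_zero_of_mul (right_ne_zero_of_mul h)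

theorem reducedPf_ne_zero_of_integrandEYM_ne_zero {r : ℕ} {g : Fin r ↪ Fin n}
    (h : integrandEYM lam lamT p q neg σ g i j ≠ 0) : reducedPf lam lamT p q neg σ i j ≠ 0 :=
  right_ne_zero_of_mul (div_ne_zero_iff.1 h).1

end Support

section Classes

theorem pairwise_disjoint_PMinus :
    Pairwise fun m m' : ℤ => Disjoint (PMinus lam lamT q m) (PMinus lam lamT q m') :=
  fun _ _ hne => Set.disjoint_left.2 fun _ hm hm' =>
    hne (add_right_cancel (hm.2.symm.trans hm'.2))

theorem pairwise_disjoint_PPlus :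
    Pairwise fun m m' : ℤ => Disjoint (PPlus lam lamT p m) (PPlus lam lamT p m') := by
  simp only [PPlus_eq_PMinus_swap]
  exact pairwise_disjoint_PMinus lamT lam p

variable {lam lamT p q}

theorem setOf_isSolution_eq_iUnion_PMinus (hmom : ∑ a, momentum lam lamT a = 0)
    (hp : ∀ a, angle (lam a) p ≠ 0) (hq : ∀ a, square (lamT a) q ≠ 0)
    (hangle : ∃ a b, angle (lam a) (lam b) ≠ 0) (hsquare : ∃ a b, square (lamT a) (lamT b) ≠ 0) :
    {σ | IsSolution lam lamT σ} = ⋃ m ∈ Set.Icc (0 : ℤ) (n - 4), PMinus lam lamT q m := by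
  obtain ⟨a, b, hab⟩ := hangle
  obtain ⟨c, d, hcd⟩ := hsquare
  have : Nonempty (Fin n) := ⟨a⟩
  refine Set.Subset.antisymm (fun σ hsol => ?_) (Set.iUnion₂_subset fun m _ σ hσ => hσ.1)
  have hrank := rank_discPlus_add_rank_discMinus_add_two_le hmom hp hq hsol
  have hminus := one_le_rank_discMinus lamT q hsol.1 hab
  have hplus := one_le_rank_discMinus lam p hsol.1 (square_ne_zero_iff.1 hcd)
  rw [← rank_discPlus] at hplus
  exact Set.mem_iUnion₂.2 ⟨(discMinus lam lamT q σ).rank - 1, ⟨by omega, by omega⟩, hsol,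
    by omega⟩

theorem setOf_isSolution_eq_iUnion_PPlus (hmom : ∑ a, momentum lam lamT a = 0)
    (hp : ∀ a, angle (lam a) p ≠ 0) (hq : ∀ a, square (lamT a) q ≠ 0)
    (hangle : ∃ a b, angle (lam a) (lam b) ≠ 0) (hsquare : ∃ a b, square (lamT a) (lamT b) ≠ 0) :
    {σ | IsSolution lam lamT σ} = ⋃ m ∈ Set.Icc (0 : ℤ) (n - 4), PPlus lam lamT p m := by
  simp only [PPlus_eq_PMinus_swap, ← isSolution_swap lam lamT]
  simp only [← square_ne_zero_iff] at hp hangle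
  simp only [square_ne_zero_iff] at hq hsquare
  exact setOf_isSolution_eq_iUnion_PMinus (sum_momentum_swap hmom) hq hp hsquare hangle

end Classes

end Kinematics

end CHY

theorem theorem1 {n : ℕ} (lam lamT : Fin n → CHY.Spinor) (p q : CHY.Spinor)
    (hmom : ∑ a, CHY.momentum lam lamT a = 0)
    (hp : ∀ a, CHY.angle (lam a) p ≠ 0) (hq : ∀ a, CHY.square (lamT a) q ≠ 0) :
    -- the ranks of the discriminant matrices partition the solution set
    ((∃ a b, CHY.angle (lam a) (lam b) ≠ 0) → (∃ a b, CHY.square (lamT a) (lamT b) ≠ 0) →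
      {σ | CHY.IsSolution lam lamT σ} =
          ⋃ m ∈ Set.Icc (0 : ℤ) ((n : ℤ) - 4), CHY.PMinus lam lamT q m ∧
      {σ | CHY.IsSolution lam lamT σ} =
          ⋃ m ∈ Set.Icc (0 : ℤ) ((n : ℤ) - 4), CHY.PPlus lam lamT p m) ∧
    Pairwise (fun m m' : ℤ => Disjoint (CHY.PMinus lam lamT q m) (CHY.PMinus lam lamT q m')) ∧
    Pairwise (fun m m' : ℤ => Disjoint (CHY.PPlus lam lamT p m) (CHY.PPlus lam lamT p m')) ∧
    -- support of the reduced Pfaffian and of the integrands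
    ∀ σ : Fin n → ℂ, CHY.IsSolution lam lamT σ →
    ∀ (neg : Finset (Fin n)) (k : ℤ) (i j : Fin n), i < j →
      -- N^k MHV and the classes of the first kind
      (CHY.IsNkMHV neg k →
        (CHY.reducedPf lam lamT p q neg σ i j ≠ 0 → σ ∈ CHY.PMinus lam lamT q k) ∧
        (CHY.integrandYM lam lamT p q neg σ i j ≠ 0 → σ ∈ CHY.PMinus lam lamT q k) ∧
        (CHY.integrandGravity lam lamT p q neg σ i j ≠ 0 → σ ∈ CHY.PMinus lam lamT q k) ∧
        (∀ (r : ℕ) (g : Fin r ↪ Fin n), CHY.integrandEYM lam lamT p q neg σ g i j ≠ 0 →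
          σ ∈ CHY.PMinus lam lamT q k)) ∧
      -- N^(n-k-4) MHV and the classes of the second kind
      (CHY.IsNkMHV neg ((n : ℤ) - k - 4) →
        (CHY.reducedPf lam lamT p q neg σ i j ≠ 0 → σ ∈ CHY.PPlus lam lamT p k) ∧
        (CHY.integrandYM lam lamT p q neg σ i j ≠ 0 → σ ∈ CHY.PPlus lam lamT p k) ∧
        (CHY.integrandGravity lam lamT p q neg σ i j ≠ 0 → σ ∈ CHY.PPlus lam lamT p k) ∧
        (∀ (r : ℕ) (g : Fin r ↪ Fin n), CHY.integrandEYM lam lamT p q neg σ g i j ≠ 0 →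
          σ ∈ CHY.PPlus lam lamT p k)) := by
  refine ⟨fun hangle hsquare =>
      ⟨CHY.setOf_isSolution_eq_iUnion_PMinus hmom hp hq hangle hsquare,
        CHY.setOf_isSolution_eq_iUnion_PPlus hmom hp hq hangle hsquare⟩,
    CHY.pairwise_disjoint_PMinus lam lamT q, CHY.pairwise_disjoint_PPlus lam lamT p,
    fun σ hsol neg k i j hij => ⟨fun hneg => ?_, fun hneg => ?_⟩⟩
  · have hmem := CHY.mem_PMinus_of_reducedPf_ne_zero hmom hp hq hsol hneg hij.ne
    exact ⟨hmem, fun h => hmem (CHY.reducedPf_ne_zero_of_integrandYM_ne_zero h),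
      fun h => hmem (CHY.reducedPf_ne_zero_of_integrandGravity_ne_zero h),
      fun _ _ h => hmem (CHY.reducedPf_ne_zero_of_integrandEYM_ne_zero h)⟩
  · have hmem := CHY.mem_PPlus_of_reducedPf_ne_zero hmom hp hq hsol hneg hij.ne
    exact ⟨hmem, fun h => hmem (CHY.reducedPf_ne_zero_of_integrandYM_ne_zero h),
      fun h => hmem (CHY.reducedPf_ne_zero_of_integrandGravity_ne_zero h),
      fun _ _ h => hmem (CHY.reducedPf_ne_zero_of_integrandEYM_ne_zero h)⟩
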